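/- **Theorem.** For every finite set $S\subset\mathbb{R}^2$ and every $\varepsilon\in(0,\frac19)$, every graph $G=\textsc{SparseYao}(S,\varepsilon)$ returned by the algorithm below is a Euclidean $(1+\varepsilon)$-spanner for $S$: between any two points $p,q\in S$ it contains a path whose total Euclidean edge length is at most $(1+\varepsilon)\|pq\|$. This holds for every way of resolving the choices that the algorithm leaves open (the position of the cones, whether cones are closed or half-open, the choice among several closest points, and the order of ties in sorting). *Regions.* For distinct points $p,q$, let $A(p,q)$ be the segment of length $\frac{\sqrt\varepsilon}{16}\|pq\|$ on the line $pq$ that has one endpoint at $p$ and is interior-disjoint from the ray $\overrightarrow{pq}$, and let $\widehat A(p,q)$ be the set of points within distance at most $\frac{\varepsilon}{64}\|pq\|$ from $A(p,q)$. Let $W_1$ be the cone with apex $p$ and aperture $\frac12\sqrt\varepsilon$, let $W_2$ be the cone with apex $q$ and aperture $\sqrt\varepsilon$, both closed and with symmetry axis in direction $\overrightarrow{pq}$, and let $B(p,q)=W_1\cap W_2$. *Preprocessing.* Let $k=\lceil 16\pi/\sqrt\varepsilon\rceil$. Subdivide $\mathbb{R}^2$ into $k$ congruent cones $C_1,\dots,C_k$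 of aperture $2\pi/k$ with apex at the origin, in cyclic order (indices modulo $k$), let $\overrightarrow{r}_i$ be the symmetry axis of $C_i$, and subdivide each $C_i$ into $k$ congruent cones $C_{i,1},\dots,C_{i,k}$ of aperture $2\pi/k^2$. Let $C_i(s)$ and $C_{i,j}(s)$ be the translates of these cones to apex $s$. For $s\in S$, let $q_i(s)$ be a closest point to $s$ in $C_i(s)\cap(S\setminus\{s\})$, if one exists. For $f\ge 0$, let $q_{i,j}(s,f)$ be a closest point to $s$ among the points $x\in C_{i,j}(s)\cap S$ with $\|sx\|>f$, if one exists. For every $j\in\mathbb{Z}$, let $L_{i,j}$ be the list of all pairs $(s,q_i(s))$ with $2^{-j}\le\|s\,q_i(s)\|<2^{1-j}$, sorted by decreasing orthogonal projection of $s$ to $\overrightarrow{r}_i$, and let $L_i$ be the concatenation of the lists $L_{i,j}$ by decreasing $j$ (shorter edges first). *Main phase.* Start with $E=\emptyset$. For each $i\in\{1,\dots,k\}$, while $L_i$ is nonempty: take the first pair $(p,q_i)$ of $L_i$, where $q_i=q_i(p)$; add the edge $pq_i$ to $E$; for all $i'\in\{i-1,i,i+1\}$ and $j\in\{1,\dots,k\}$,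 add the edge $p\,q_{i',j}$ to $E$ if the point $q_{i',j}:=q_{i',j}(p,\frac13\|pq_i\|)$ exists and $q_{i',j}\notin B(p,q_i)$; then delete from $L_i$ every pair $(s,q_i(s))$ with $s\in\widehat A(p,q_i)$, including $s=p$. Return $G=(S,E)$. -/

import Mathlib

namespace SparseYao

noncomputable section

/-- The Euclidean plane. -/
abbrev Plane : Type := EuclideanSpace ℝ (Fin 2)

/-! ### Spanners -/

/-- The weight of a walk in a graph whose vertices are points of a metric space: the sum of the
lengths of its edges. -/
def weight {X : Type*} [MetricSpace X] {G : SimpleGraph X} {p q : X} (w : G.Walk p q) : ℝ :=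
  (w.darts.map fun d => dist d.fst d.snd).sum

/-- `G` is a `t`-spanner: between every two points it contains a path of weight at most `t` times
their distance. -/
def IsSpanner {X : Type*} [MetricSpace X] (G : SimpleGraph X) (t : ℝ) : Prop :=
  ∀ p q : X, ∃ w : G.Walk p q, w.IsPath ∧ weight w ≤ t * dist p q

/-! ### The regions `A`, `Â`, `W₁`, `W₂` and `B` -/

/-- The closed cone with the given apex, with symmetry axis in direction `u`, and aperture `a`. -/
def cone (apex u : Plane) (a : ℝ) : Set Plane :=
  {x | x = apex ∨ InnerProductGeometry.angle u (x - apex) ≤ a / 2}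

/-- The segment `A(p,q)`, of length `(√ε / 16) ‖pq‖`, from `p` in the direction opposite to `q`. -/
def regionA (ε : ℝ) (p q : Plane) : Set Plane :=
  segment ℝ p (p - (√ε / 16) • (q - p))

/-- The region `Â(p,q)`: the points within distance `(ε / 64) ‖pq‖` from `A(p,q)`. -/
def regionAHat (ε : ℝ) (p q : Plane) : Set Plane :=
  {x | ∃ a ∈ regionA ε p q, dist x a ≤ ε / 64 * dist p q}

/-- The region `B(p,q) = W₁ ∩ W₂`. -/
def regionB (ε : ℝ) (p q : Plane) : Set Plane :=
  cone p (q - p) (√ε / 2) ∩ cone q (q - p) √ε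

/-! ### The subdivision of the plane into cones -/

/-- The number `k = ⌈16 π / √ε⌉` of cones. -/
def numCones (ε : ℝ) : ℕ := ⌈16 * Real.pi / √ε⌉₊

/-- Which of its two bounding rays a cone of the subdivision contains: both of them (closed cones,
which overlap in common rays), or only the first, or only the last one in counterclockwise order
(half-open cones, which are disjoint apart from the apex). -/
inductive BoundaryRule where
  | both
  | first
  | last

/-- The interval of angles from `α` to `β`. -/
def BoundaryRule.interval : BoundaryRule → ℝ → ℝ → Set ℝ
  | .both, α, β => Set.Icc α β
  | .first, α, β => Set.Ico α β
  | .last, α, β => Set.Ioc α β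

/-- The unit vector of angle `φ`. -/
def dir (φ : ℝ) : Plane := !₂[Real.cos φ, Real.sin φ]

/-- The cone with apex at the origin between the rays of angles `α` and `α + a`. -/
def sector (b : BoundaryRule) (α a : ℝ) : Set Plane :=
  {v | ∃ r : ℝ, 0 ≤ r ∧ ∃ φ ∈ b.interval α (α + a), v = r • dir φ}

/-- The cone `C_i(s)`, one of `k` congruent cones of aperture `2π / k`; here `θ` is the angle of
the ray at which the subdivision starts, and the indices run from `0` to `k - 1`. -/
def bigCone (b : BoundaryRule) (θ : ℝ) {k : ℕ} (i : Fin k) (s : Plane) : Set Plane :=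
  {x | x - s ∈ sector b (θ + i * (2 * Real.pi / k)) (2 * Real.pi / k)}

/-- The direction of the symmetry axis of the cones `C_i(s)`. -/
def axis (θ : ℝ) {k : ℕ} (i : Fin k) : Plane :=
  dir (θ + i * (2 * Real.pi / k) + Real.pi / k)

/-- The cone `C_{i,j}(s)`, one of the `k` congruent cones of aperture `2π / k²` into which
`C_i(s)` is subdivided. -/
def smallCone (b : BoundaryRule) (θ : ℝ) {k : ℕ} (i j : Fin k) (s : Plane) : Set Plane :=
  {x | x - s ∈ sector b (θ + i * (2 * Real.pi / k) + j * (2 * Real.pi / k ^ 2))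
    (2 * Real.pi / k ^ 2)}

/-- The indices `i' ∈ {i - 1, i, i + 1}`, in the cyclic order of the cones. -/
def neighbors {k : ℕ} (i : Fin k) : Set (Fin k) :=
  {i' | ∃ δ : ℤ, (δ = -1 ∨ δ = 0 ∨ δ = 1) ∧ (i' : ℤ) ≡ (i : ℤ) + δ [ZMOD (k : ℤ)]}

/-! ### Preprocessing phase -/

/-- `o` is a closest point to `s` among the points of `T`, if there is any, and `none`
otherwise. -/
def IsClosest {X : Type*} [MetricSpace X] (s : X) (T : Set X) : Option X → Prop
  | none => T = ∅
  | some t => t ∈ T ∧ ∀ x ∈ T, dist s t ≤ dist s x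

/-- The integer `j` with `2 ^ (-j) ≤ d < 2 ^ (1 - j)`, for `d > 0`. -/
def scale (d : ℝ) : ℤ := -Int.log 2 d

theorem scale_eq_iff {d : ℝ} (hd : 0 < d) (j : ℤ) :
    scale d = j ↔ (2 : ℝ) ^ (-j) ≤ d ∧ d < (2 : ℝ) ^ (1 - j) := by
  have h1 := Int.zpow_le_iff_le_log (b := 2) one_lt_two (x := -j) hd
  have h2 := Int.lt_zpow_iff_log_lt (b := 2) one_lt_two (x := 1 - j) hd
  push_cast at h1 h2
  rw [h1, h2, scale]
  omega

/-- The order of a list `L_i` with axis direction `r`: the pair `e` may stand before `e'` if it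
has the larger scale `j` (a shorter edge), or if both have the same scale and the projection of
the first point of `e` to the axis is at least that of the first point of `e'`. -/
def Precedes {S : Finset Plane} (r : Plane) (e e' : S × S) : Prop :=
  scale (dist e'.1 e'.2) < scale (dist e.1 e.2) ∨
    scale (dist e'.1 e'.2) = scale (dist e.1 e.2) ∧
      inner ℝ r (e'.1 : Plane) ≤ inner ℝ r (e.1 : Plane)

/-- A possible result of the preprocessing phase on input `(S, ε)`. It records the choices that
the algorithm leaves open: the position of the cones, the closest points, and the order of pairs
that tie in the lists. -/
structure Preprocessing (S : Finset Plane) (ε : ℝ) where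
  /-- The convention on the bounding rays of the cones. -/
  rule : BoundaryRule
  /-- The angle at which the subdivision into cones starts. -/
  θ : ℝ
  /-- The point `q_i(s)`. -/
  q : Fin (numCones ε) → S → Option S
  q_spec : ∀ i s, IsClosest s {t : S | t ≠ s ∧ (t : Plane) ∈ bigCone rule θ i s} (q i s)
  /-- The point `q_{i,j}(s, f)`. -/
  qq : Fin (numCones ε) → Fin (numCones ε) → S → ℝ → Option S
  qq_spec : ∀ i j s f, 0 ≤ f →
    IsClosest s {t : S | (t : Plane) ∈ smallCone rule θ i j s ∧ f < dist s t} (qq i j s f)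
  /-- The list `L_i`, consisting of all pairs `(s, q_i(s))`. -/
  L : Fin (numCones ε) → List (S × S)
  L_nodup : ∀ i, (L i).Nodup
  mem_L : ∀ i e, e ∈ L i ↔ q i e.1 = some e.2
  L_sorted : ∀ i, (L i).Pairwise (Precedes (axis θ i))

/-! ### Main phase -/

open Classical in
/-- The edges that the while loop for the index `i` adds when it is started with the list `l` in
the place of `L_i`. With `(p, q_i)` the first pair of the list, the loop adds `p q_i` and all
`p q_{i',j}` with `i' ∈ {i - 1, i, i + 1}` and `q_{i',j} = q_{i',j}(p, ‖p q_i‖ / 3) ∉ B(p, q_i)`,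
deletes the first pair and all pairs whose first point lies in `Â(p, q_i)`, and continues. -/
def loopEdges {S : Finset Plane} {ε : ℝ} (P : Preprocessing S ε) (i : Fin (numCones ε)) :
    List (S × S) → Set (Sym2 S)
  | [] => ∅
  | (p, q) :: l =>
    {s(p, q)} ∪
    {e | ∃ i' ∈ neighbors i, ∃ j, ∃ x : S,
      P.qq i' j p (dist p q / 3) = some x ∧ (x : Plane) ∉ regionB ε p q ∧ e = s(p, x)} ∪
    loopEdges P i (l.filter fun e => (e.1 : Plane) ∉ regionAHat ε p q)
termination_by l => l.length
decreasing_by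
  rw [List.length_unattach]
  exact Nat.lt_succ_of_le ((List.length_filter_le _ _).trans List.length_attach.le)

/-- The graph on `S` returned by the algorithm, when its preprocessing phase has result `P`. -/
def graph {S : Finset Plane} {ε : ℝ} (P : Preprocessing S ε) : SimpleGraph S :=
  SimpleGraph.fromEdgeSet (⋃ i, loopEdges P i (P.L i))

theorem exists_isClosest {S : Finset Plane} (s : S) (T : Set S) : ∃ o, IsClosest s T o := by
  rcases T.eq_empty_or_nonempty with h | h
  · exact ⟨none, h⟩
  · obtain ⟨t, ht, hm⟩ := T.toFinite.exists_minimalFor (fun x => dist s x) T h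
    refine ⟨some t, ht, fun x hx => ?_⟩
    rcases le_total (dist s t) (dist s x) with h | h
    · exact h
    · exact hm hx h

open Classical in
/-- The preprocessing phase always has a result, for every position of the cones. -/
theorem exists_preprocessing (S : Finset Plane) (ε : ℝ) (rule : BoundaryRule) (θ : ℝ) :
    ∃ P : Preprocessing S ε, P.rule = rule ∧ P.θ = θ := by
  choose q hq using fun (i : Fin (numCones ε)) (s : S) =>
    exists_isClosest s {t : S | t ≠ s ∧ (t : Plane) ∈ bigCone rule θ i s}
  choose qq hqq using fun (i j : Fin (numCones ε)) (s : S) (f : ℝ) =>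
    exists_isClosest s {t : S | (t : Plane) ∈ smallCone rule θ i j s ∧ f < dist s t}
  let F : Fin (numCones ε) → List (S × S) := fun i =>
    (Finset.univ.filter fun e : S × S => q i e.1 = some e.2).toList
  refine ⟨{ rule := rule, θ := θ, q := q, q_spec := hq, qq := qq,
            qq_spec := fun i j s f _ => hqq i j s f
            L := fun i => (F i).insertionSort (Precedes (axis θ i))
            L_nodup := fun i => ?_
            mem_L := fun i e => ?_
            L_sorted := fun i => ?_ }, rfl, rfl⟩
  · exact (List.perm_insertionSort _ _).nodup_iff.2 (Finset.nodup_toList _)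
  · simp [F]
  · have : Std.Total (Precedes (S := S) (axis θ i)) := ⟨fun a b => by
      unfold Precedes
      rcases lt_trichotomy (scale (dist a.1 a.2)) (scale (dist b.1 b.2)) with h | h | h
      · exact Or.inr (Or.inl h)
      · rcases le_total (inner ℝ (axis θ i) (a.1 : Plane)) (inner ℝ (axis θ i) (b.1 : Plane))
          with h' | h'
        · exact Or.inr (Or.inr ⟨h, h'⟩)
        · exact Or.inl (Or.inr ⟨h.symm, h'⟩)
      · exact Or.inl (Or.inl h)⟩
    have : IsTrans (S × S) (Precedes (S := S) (axis θ i)) := ⟨fun a b c hab hbc => by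
      unfold Precedes at *
      rcases hab with h | ⟨h, h'⟩ <;> rcases hbc with g | ⟨g, g'⟩
      · exact Or.inl (g.trans h)
      · exact Or.inl (g ▸ h)
      · exact Or.inl (h ▸ g)
      · exact Or.inr ⟨g.trans h, g'.trans h'⟩⟩
    exact List.pairwise_insertionSort _ _

end

end SparseYao

namespace SparseYao

/-! ### Walks and their weights -/

section Walks

variable {X : Type*} [MetricSpace X] {G : SimpleGraph X}

/-! Write `ε = e²` and induct on `dist a b`. Let `C_i(a)` contain `b`, with closest point `c`. Some
pair `(p, q)` deletes `(a, c)` (`exists_deleting_pair`), so `a` lies in `Â(p, q)`, and the order by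
scale gives `|pq| < 2|ac| ≤ 2|ab|`. Since `a` lies almost straight behind `p`, replacing `a` by `p`
turns the direction to `b` by less than `e/10` and costs a detour of at most `ε|pq|/30`
(`exists_angle_and_detour_bounds`). Hence `b` is in a thin cone at `p` belonging to `C_i` or a
neighbor (`exists_mem_smallCone_neighbors`), and the closest point `x` in that cone beyond `|pq|/3`
exists. The path goes from `a` to `p` by induction, along one edge `py`, then from `y` to `b` by
induction. If `x ∉ B(p, q)`, then `px` is an edge and `y = x` works because the cone is thin.
Otherwise `y = q` works: if `b` is far, because `q` and `b` are seen from `p` at a small angle; if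
`b` is near, because `x ∈ W₂` makes the detour from `p` over `q` to `x` short. -/

theorem weight_nonneg {p q : X} (w : G.Walk p q) : 0 ≤ weight w :=
  List.sum_nonneg fun x hx => by
    obtain ⟨d, -, rfl⟩ := List.mem_map.1 hx
    exact dist_nonneg

theorem weight_append {p q r : X} (w : G.Walk p q) (w' : G.Walk q r) :
    weight (w.append w') = weight w + weight w' := by
  simp [weight]

/-- Loop erasure: cutting off a closed initial part cannot increase the weight. All later
constructions can therefore use walks. -/
theorem exists_isPath_weight_le {p q : X} (w : G.Walk p q) :
    ∃ w' : G.Walk p q, w'.IsPath ∧ weight w' ≤ weight w := by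
  classical
  induction w with
  | nil => exact ⟨.nil, .nil, le_rfl⟩
  | @cons u v x h w ih =>
    obtain ⟨w', hw', hle⟩ := ih
    have hc : weight (SimpleGraph.Walk.cons h w) = dist u v + weight w := by simp [weight]
    by_cases hu : u ∈ w'.support
    · refine ⟨w'.dropUntil u hu, hw'.dropUntil hu, ?_⟩
      have h1 := weight_append (w'.takeUntil u hu) (w'.dropUntil u hu)
      rw [w'.take_spec hu] at h1
      have h2 := weight_nonneg (w'.takeUntil u hu)
      have h3 : 0 ≤ dist u v := dist_nonneg
      linarith
    · refine ⟨.cons h w', (SimpleGraph.Walk.cons_isPath_iff h w').2 ⟨hw', hu⟩, ?_⟩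
      have : weight (SimpleGraph.Walk.cons h w') = dist u v + weight w' := by simp [weight]
      linarith

/-- The points `p` and `q` are joined by a walk of weight at most `c`. -/
def Joined (G : SimpleGraph X) (p q : X) (c : ℝ) : Prop :=
  ∃ w : G.Walk p q, weight w ≤ c

theorem Joined.refl (p : X) {c : ℝ} (hc : 0 ≤ c) : Joined G p p c :=
  ⟨.nil, by simpa [weight] using hc⟩

theorem Joined.of_adj {p q : X} (h : G.Adj p q) : Joined G p q (dist p q) :=
  ⟨h.toWalk, by simp [weight]⟩

theorem Joined.trans {p q r : X} {c d : ℝ} (h : Joined G p q c) (h' : Joined G q r d) :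
    Joined G p r (c + d) := by
  obtain ⟨w, hw⟩ := h
  obtain ⟨w', hw'⟩ := h'
  exact ⟨w.append w', by rw [weight_append]; linarith⟩

theorem Joined.mono {p q : X} {c d : ℝ} (h : Joined G p q c) (hcd : c ≤ d) : Joined G p q d :=
  let ⟨w, hw⟩ := h
  ⟨w, hw.trans hcd⟩

end Walks

/-! ### The main loop -/

/-- Every pair of the list is deleted in an iteration whose first pair is not after it. -/
theorem exists_deleting_pair {S : Finset Plane} {ε : ℝ} (P : Preprocessing S ε)
    (i : Fin (numCones ε)) (r : Plane) (n : ℕ) :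
    ∀ l : List (S × S), l.length ≤ n → l.Pairwise (Precedes r) → ∀ e ∈ l, ∃ p q : S,
      (p, q) ∈ l ∧ ((p, q) = e ∨ Precedes r (p, q) e) ∧
      ((e.1 : Plane) ∈ regionAHat ε p q ∨ e.1 = p) ∧
      s(p, q) ∈ loopEdges P i l ∧
      ∀ i' ∈ neighbors i, ∀ j, ∀ x : S, P.qq i' j p (dist p q / 3) = some x →
        (x : Plane) ∉ regionB ε p q → s(p, x) ∈ loopEdges P i l := by
  classical
  -- The recursion continues on a filtered list, not on the tail, so the induction is on a bound for
  -- the length.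
  induction n with
  | zero =>
    intro l hl _ e he
    rw [List.length_eq_zero_iff.1 (Nat.le_zero.1 hl)] at he
    simp at he
  | succ n ih =>
    rintro (_ | ⟨⟨p, q⟩, l⟩) hl hs e he
    · simp at he
    rw [List.pairwise_cons] at hs
    by_cases hA : (e.1 : Plane) ∈ regionAHat ε p q ∨ e.1 = p
    · refine ⟨p, q, List.mem_cons_self, ?_, hA, ?_, ?_⟩
      · rcases List.mem_cons.1 he with h | h
        · exact Or.inl h.symm
        · exact Or.inr (hs.1 e h)
      · rw [loopEdges]
        exact Or.inl (Or.inl rfl)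
      · intro i' hi' j x hx hxB
        rw [loopEdges]
        exact Or.inl (Or.inr ⟨i', hi', j, x, hx, hxB, rfl⟩)
    · have he' : e ∈ l := (List.mem_cons.1 he).resolve_left fun h => hA (Or.inr (by rw [h]))
      set l' := l.filter fun e => (e.1 : Plane) ∉ regionAHat ε p q with hl'
      have hsub : l'.Sublist l := List.filter_sublist
      obtain ⟨p', q', h1, h2, h3, h4, h5⟩ := ih l'
        (hsub.length_le.trans (Nat.le_of_succ_le_succ hl)) (hs.2.sublist hsub) e
        (List.mem_filter.2 ⟨he', decide_eq_true fun h => hA (Or.inl h)⟩)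
      refine ⟨p', q', List.mem_cons_of_mem _ (hsub.subset h1), h2, h3, ?_, ?_⟩
      · rw [loopEdges]
        exact Or.inr h4
      · intro i' hi' j x hx hxB
        rw [loopEdges]
        exact Or.inr (h5 i' hi' j x hx hxB)

/-! ### Unit vectors -/

theorem inner_eq_coords (x y : Plane) : inner ℝ x y = x 0 * y 0 + x 1 * y 1 := by
  simp [PiLp.inner_apply, Fin.sum_univ_two, mul_comm]

theorem inner_dir (φ ψ : ℝ) : inner ℝ (dir φ) (dir ψ) = Real.cos (φ - ψ) := by
  rw [Real.cos_sub]
  simp [dir, inner_eq_coords]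

theorem norm_dir (φ : ℝ) : ‖dir φ‖ = 1 := by
  have h := real_inner_self_eq_norm_sq (dir φ)
  rw [inner_dir, sub_self, Real.cos_zero] at h
  nlinarith [norm_nonneg (dir φ)]

theorem norm_smul_dir {r : ℝ} (hr : 0 ≤ r) (φ : ℝ) : ‖r • dir φ‖ = r := by
  rw [norm_smul, norm_dir, Real.norm_of_nonneg hr, mul_one]

/-- A chord is no longer than its arc: the squared norm is `2 - 2 cos (φ - ψ)`. -/
theorem norm_dir_sub_dir_le (φ ψ : ℝ) : ‖dir φ - dir ψ‖ ≤ |φ - ψ| := by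
  refine abs_le_of_sq_le_sq' ?_ (abs_nonneg _) |>.2
  rw [norm_sub_sq_real, norm_dir, norm_dir, inner_dir, sq_abs]
  linarith [Real.one_sub_sq_div_two_le_cos (x := φ - ψ)]

theorem dir_add_int_mul_two_pi (φ : ℝ) (n : ℤ) : dir (φ + n * (2 * Real.pi)) = dir φ := by
  simp [dir, Real.cos_add_int_mul_two_pi, Real.sin_add_int_mul_two_pi]

theorem exists_eq_norm_smul_dir (v : Plane) : ∃ φ, v = ‖v‖ • dir φ := by
  have hn : ‖v‖ = ‖(⟨v 0, v 1⟩ : ℂ)‖ := by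
    rw [EuclideanSpace.norm_eq, Fin.sum_univ_two, Complex.norm_def, Complex.normSq_mk]
    simp [sq]
  refine ⟨Complex.arg ⟨v 0, v 1⟩, ?_⟩
  ext k
  fin_cases k
  · simp [dir, hn, Complex.norm_mul_cos_arg]
  · simp [dir, hn, Complex.norm_mul_sin_arg]

theorem abs_arctan_le (y : ℝ) : |Real.arctan y| ≤ |y| := by
  have key : ∀ y : ℝ, 0 ≤ y → Real.arctan y ≤ y := fun y hy => by
    have h := Real.le_tan (Real.arctan_nonneg.2 hy) (Real.arctan_lt_pi_div_two y)
    rwa [Real.tan_arctan] at h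
  rcases le_total 0 y with hy | hy
  · rw [abs_of_nonneg hy, abs_of_nonneg (Real.arctan_nonneg.2 hy)]
    exact key y hy
  · rw [abs_of_nonpos hy, abs_of_nonpos (Real.arctan_le_zero.2 hy), ← Real.arctan_neg]
    exact key _ (by linarith)

/-- Turns a slope into an angle; with `abs_arctan_le`, the ratio of the components then bounds the
deviation of the direction. -/
theorem dir_add_arctan (φ y : ℝ) :
    dir (φ + Real.arctan y) =
      Real.cos (Real.arctan y) • (dir φ + y • dir (φ + Real.pi / 2)) := by
  have h : Real.sin (Real.arctan y) = y * Real.cos (Real.arctan y) := by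
    rw [Real.sin_arctan, Real.cos_arctan]; ring
  ext k
  fin_cases k
  · simp [dir, Real.cos_add, h]; ring
  · simp [dir, Real.sin_add, Real.cos_add, h]; ring

theorem eq_inner_smul_add (v : Plane) (φ : ℝ) :
    v = inner ℝ (dir φ) v • dir φ +
      inner ℝ (dir (φ + Real.pi / 2)) v • dir (φ + Real.pi / 2) := by
  have h := Real.sin_sq_add_cos_sq φ
  ext k
  fin_cases k
  · simp [dir, inner_eq_coords, Real.cos_add, Real.sin_add]
    linear_combination -v 0 * h
  · simp [dir, inner_eq_coords, Real.cos_add, Real.sin_add]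
    linear_combination -v 1 * h

/-- A vector with positive component in direction `φ` has a polar angle close to `φ`. -/
theorem exists_polar_angle (v : Plane) (φ : ℝ) (hv : 0 < inner ℝ (dir φ) v) :
    ∃ φ', v = ‖v‖ • dir φ' ∧
      |φ' - φ| ≤ |inner ℝ (dir (φ + Real.pi / 2)) v| / inner ℝ (dir φ) v := by
  set a : ℝ := inner ℝ (dir φ) v with ha
  set c : ℝ := inner ℝ (dir (φ + Real.pi / 2)) v with hc
  have hcos := Real.cos_arctan_pos (c / a)
  have hv' : v = (a / Real.cos (Real.arctan (c / a))) • dir (φ + Real.arctan (c / a)) := by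
    rw [dir_add_arctan, smul_smul, div_mul_cancel₀ _ hcos.ne', smul_add, smul_smul,
      mul_div_cancel₀ _ hv.ne']
    exact eq_inner_smul_add v φ
  refine ⟨φ + Real.arctan (c / a), ?_, ?_⟩
  · conv_rhs => rw [hv', norm_smul_dir (div_pos hv hcos).le]
    exact hv'
  · rw [add_sub_cancel_left, ← abs_of_pos hv, ← abs_div, abs_of_pos hv]
    exact abs_arctan_le _

/-! ### Distance estimates -/

theorem one_sub_le_inner_dir (φ ψ : ℝ) : 1 - (φ - ψ) ^ 2 / 2 ≤ inner ℝ (dir φ) (dir ψ) := by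
  rw [inner_dir]; exact Real.one_sub_sq_div_two_le_cos

theorem inner_dir_le_norm (φ : ℝ) (v : Plane) : inner ℝ (dir φ) v ≤ ‖v‖ := by
  have := real_inner_le_norm (dir φ) v
  rwa [norm_dir, one_mul] at this

theorem abs_inner_dir_le_norm (φ : ℝ) (v : Plane) : |inner ℝ (dir φ) v| ≤ ‖v‖ := by
  have := abs_real_inner_le_norm (dir φ) v
  rwa [norm_dir, one_mul] at this

/-- Moving towards a target in almost the right direction. -/
theorem norm_smul_dir_sub_smul_dir_le {m D φ ψ t : ℝ} (hm : 0 ≤ m) (hmD : m ≤ D)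
    (h : |φ - ψ| ≤ t) : ‖D • dir φ - m • dir ψ‖ ≤ D - (1 - t) * m := by
  -- The intermediate point is `m • dir φ`; the remaining chord has length at most `m * t`.
  have h1 : D • dir φ - m • dir ψ = (D - m) • dir φ + m • (dir φ - dir ψ) := by
    rw [sub_smul, smul_sub]; abel
  have h2 : ‖m • (dir φ - dir ψ)‖ ≤ m * t := by
    rw [norm_smul, Real.norm_of_nonneg hm]
    exact mul_le_mul_of_nonneg_left ((norm_dir_sub_dir_le φ ψ).trans h) hm
  have h3 := norm_add_le ((D - m) • dir φ) (m • (dir φ - dir ψ))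
  rw [norm_smul_dir (sub_nonneg.2 hmD)] at h3
  rw [h1]
  linarith

/-- The detour over a point at distance `ρ` is small for targets at distance at least `2 * ρ`. -/
theorem norm_smul_dir_sub_smul_dir_le_of_two_mul_le {ρ D φ ψ g : ℝ} (hρ : 0 ≤ ρ)
    (hD : 2 * ρ ≤ D) (h : (φ - ψ) ^ 2 ≤ g) : ‖D • dir φ - ρ • dir ψ‖ ≤ D - ρ + ρ * g := by
  have hg : 0 ≤ g := (sq_nonneg _).trans h
  have hρg := mul_nonneg hρ hg
  refine abs_le_of_sq_le_sq' ?_ (by linarith) |>.2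
  rw [norm_sub_sq_real, norm_smul_dir hρ, norm_smul_dir (by linarith : 0 ≤ D),
    real_inner_smul_left, real_inner_smul_right]
  have h1 := one_sub_le_inner_dir φ ψ
  have h2 : D * ρ * (1 - g / 2) ≤ D * ρ * inner ℝ (dir φ) (dir ψ) :=
    mul_le_mul_of_nonneg_left (by linarith) (mul_nonneg (by linarith) hρ)
  -- The left side is at most `(D - ρ)² + Dρg`, the right side at least `(D - ρ)² + 2(D - ρ)ρg`;
  -- they compare because `D ≥ 2ρ`.
  nlinarith [mul_nonneg hρg (sub_nonneg.2 hD), sq_nonneg (ρ * g)]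

/-- The detour over the apex of a cone that contains the target. -/
theorem dist_add_dist_sub_dist_le_of_mem_cone {p q x : Plane} {a : ℝ}
    (ha : a ≤ 2 * Real.pi) (hx : x ∈ cone q (q - p) a) :
    dist p q + dist q x - dist p x ≤ dist p q * (a ^ 2 / 8) := by
  rcases hx with rfl | hx
  · have := mul_nonneg (dist_nonneg (x := p) (y := x)) (by positivity : 0 ≤ a ^ 2 / 8)
    rw [dist_self]; linarith
  · set y := x - q
    set u := q - p
    have h0 := InnerProductGeometry.angle_nonneg u y
    have hcos : 1 - a ^ 2 / 8 ≤ Real.cos (InnerProductGeometry.angle u y) := by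
      have h1 := Real.cos_le_cos_of_nonneg_of_le_pi h0 (by linarith) hx
      have h2 := Real.one_sub_sq_div_two_le_cos (x := a / 2)
      nlinarith
    have hin := InnerProductGeometry.cos_angle_mul_norm_mul_norm u y
    have hpq : dist p q = ‖u‖ := by rw [dist_comm, dist_eq_norm]
    have hqx : dist q x = ‖y‖ := by rw [dist_comm, dist_eq_norm]
    have hpx : dist p x = ‖u + y‖ := by
      rw [dist_comm, dist_eq_norm]; congr 1; simp only [u, y]; abel
    rw [hpq, hqx, hpx]
    have h1 : ‖u‖ * ‖y‖ * (1 - a ^ 2 / 8) ≤ inner ℝ u y := by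
      rw [← hin, mul_comm]
      exact mul_le_mul_of_nonneg_right hcos (by positivity)
    -- Projecting `u + y` onto `y` bounds its length from below by `‖y‖` plus nearly all of `‖u‖`.
    have h2 : ‖y‖ * (‖y‖ + ‖u‖ * (1 - a ^ 2 / 8)) ≤ ‖y‖ * ‖u + y‖ := by
      have h3 := real_inner_le_norm (u + y) y
      rw [inner_add_left, real_inner_self_eq_norm_sq] at h3
      nlinarith
    rcases (norm_nonneg y).eq_or_lt with hy | hy
    · have hy0 : y = 0 := norm_eq_zero.1 hy.symm
      rw [hy0]; simp; positivity
    · have := le_of_mul_le_mul_left h2 hy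
      linarith

/-! ### Replacing a deleted point by the apex of the deleting pair. -/

theorem self_mem_regionAHat {ε : ℝ} (hε : 0 ≤ ε) (p q : Plane) : p ∈ regionAHat ε p q :=
  ⟨p, left_mem_segment _ _ _, by rw [dist_self]; positivity⟩

theorem exists_of_mem_regionAHat {e : ℝ} (he : 0 ≤ e) {p q a : Plane}
    (ha : a ∈ regionAHat (e ^ 2) p q) :
    ∃ t w, 0 ≤ t ∧ t ≤ e / 16 ∧ ‖w‖ ≤ e ^ 2 / 64 * dist p q ∧ p - a = t • (q - p) - w := by
  obtain ⟨c, hc, hd⟩ := ha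
  rw [regionA, Real.sqrt_sq he, segment_eq_image'] at hc
  obtain ⟨s, ⟨hs0, hs1⟩, rfl⟩ := hc
  refine ⟨s * (e / 16), a - (p + s • (p - (e / 16) • (q - p) - p)), by positivity,
    mul_le_of_le_one_left (by positivity) hs1, by rwa [← dist_eq_norm], ?_⟩
  rw [mul_smul, sub_right_comm, sub_self, zero_sub, smul_neg]
  abel

/-- The situation in which `a` is deleted by the pair `(p, q)`: the direction to `b` changes
little and the detour over `p` is short when `a` is replaced by `p`. -/
theorem exists_angle_and_detour_bounds {e r ρ φ ψ : ℝ} (he : 0 < e) (he3 : e < 1 / 3)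
    {p q a b : Plane} (hρ : 0 < ρ) (hρr : ρ < 2 * r) (hq : q - p = ρ • dir ψ)
    (hb : b - a = r • dir φ) (hφψ : |φ - ψ| ≤ e / 8) (ha : a ∈ regionAHat (e ^ 2) p q) :
    ∃ φ', b - p = ‖b - p‖ • dir φ' ∧ |φ' - φ| < e / 10 ∧ ρ / 3 < dist p b ∧
      dist a p < dist a b ∧ dist a p + dist p b - dist a b ≤ e ^ 2 / 30 * ρ := by
  obtain ⟨t, w, ht0, ht, hw, hpa⟩ := exists_of_mem_regionAHat he.le ha
  have hr : 0 < r := by linarith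
  have hpq : dist p q = ρ := by rw [dist_comm, dist_eq_norm, hq, norm_smul_dir hρ.le]
  have hab : dist a b = r := by rw [dist_comm, dist_eq_norm, hb, norm_smul_dir hr.le]
  rw [hpq] at hw
  rw [hq, smul_smul] at hpa
  have he2 : e ^ 2 < e / 3 := by nlinarith
  have hw' : e ^ 2 / 64 * ρ ≤ 1 / 576 * ρ := mul_le_mul_of_nonneg_right (by nlinarith) hρ.le
  have htρ0 : 0 ≤ t * ρ := by positivity
  have htρ : t * ρ ≤ e / 16 * ρ := mul_le_mul_of_nonneg_right ht hρ.le
  have htρ' : t * ρ ≤ 1 / 48 * ρ := mul_le_mul_of_nonneg_right (by linarith) hρ.le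
  have hap : dist a p ≤ t * ρ + ‖w‖ := by
    rw [dist_comm, dist_eq_norm, hpa]
    have := norm_sub_le ((t * ρ) • dir ψ) w
    rwa [norm_smul_dir htρ0] at this
  have hbp : b - p = r • dir φ - (t * ρ) • dir ψ + w := by
    have : b - p = (b - a) - (p - a) := by abel
    rw [this, hb, hpa]; abel
  -- From `r > ρ/2`, minus at most `ρ/48` along the segment and `ρ/576` for `w`.
  have hX : 47 / 100 * ρ < inner ℝ (dir φ) (b - p) := by
    rw [hbp, inner_add_right, inner_sub_right, real_inner_smul_right, real_inner_smul_right,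
      inner_dir, inner_dir, sub_self, Real.cos_zero]
    have h1 := (abs_le.1 (abs_inner_dir_le_norm φ w)).1
    have h2 : t * ρ * Real.cos (φ - ψ) ≤ t * ρ := mul_le_of_le_one_right htρ0 (Real.cos_le_one _)
    linarith
  -- The segment contributes `(e/16)(e/8)` and `w` contributes `e²/64`: both are of second order in
  -- `e`, so the angle change stays well below `e/10`.
  have hY : |inner ℝ (dir (φ + Real.pi / 2)) (b - p)| ≤ e ^ 2 * 3 / 128 * ρ := by
    rw [hbp, inner_add_right, inner_sub_right, real_inner_smul_right, real_inner_smul_right,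
      inner_dir, inner_dir, add_sub_cancel_left, Real.cos_pi_div_two, mul_zero, zero_sub,
      add_sub_right_comm, Real.cos_add_pi_div_two]
    have h1 := abs_inner_dir_le_norm (φ + Real.pi / 2) w
    have h2 : |t * ρ * Real.sin (φ - ψ)| ≤ e / 16 * ρ * (e / 8) := by
      rw [abs_mul, abs_of_nonneg htρ0]
      exact mul_le_mul htρ ((Real.abs_sin_le_abs).trans hφψ) (abs_nonneg _) (by positivity)
    rw [mul_neg, neg_neg]
    have h3 := abs_add_le (t * ρ * Real.sin (φ - ψ)) (inner ℝ (dir (φ + Real.pi / 2)) w)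
    nlinarith
  have hX0 : 0 < inner ℝ (dir φ) (b - p) := lt_trans (by positivity) hX
  obtain ⟨φ', hφ', hd⟩ := exists_polar_angle (b - p) φ hX0
  have hd' : |φ' - φ| < e / 10 := by
    refine hd.trans_lt ?_
    rw [div_lt_iff₀ hX0]
    have h1 : e ^ 2 * 3 / 128 * ρ ≤ e / 3 * 3 / 128 * ρ :=
      mul_le_mul_of_nonneg_right (by linarith) hρ.le
    have h2 := mul_lt_mul_of_pos_left hX (by positivity : 0 < e / 10)
    have h3 := mul_pos he hρ
    nlinarith
  have hpb : dist p b = ‖b - p‖ := by rw [dist_comm, dist_eq_norm]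
  have hpb' := inner_dir_le_norm φ (b - p)
  refine ⟨φ', hφ', hd', by rw [hpb]; linarith, by rw [hab]; linarith, ?_⟩
  have hγ : (φ' - ψ) ^ 2 ≤ e ^ 2 / 16 := by
    have h1 := abs_add_le (φ' - φ) (φ - ψ)
    rw [sub_add_sub_cancel] at h1
    have h2 : |φ' - ψ| ≤ e / 4 := by linarith
    have := sq_le_sq' (by linarith [abs_nonneg (φ' - ψ)]) h2
    rw [sq_abs] at this
    linarith
  have hcos := one_sub_le_inner_dir φ' ψ
  -- Projecting onto the direction of `b - p` keeps `dist p b` exactly. The detour is then at most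
  -- `tρe²/32 + 2‖w‖`, and `1/1536 + 1/32 < 1/30`.
  have hab' : dist p b + t * ρ * (1 - e ^ 2 / 32) - ‖w‖ ≤ dist a b := by
    have h1 := inner_dir_le_norm φ' (b - a)
    have h2 : b - a = ‖b - p‖ • dir φ' + ((t * ρ) • dir ψ - w) := by
      rw [← hφ', ← hpa]; abel
    have h3 : inner ℝ (dir φ') (b - a) =
        ‖b - p‖ + t * ρ * inner ℝ (dir φ') (dir ψ) - inner ℝ (dir φ') w := by
      rw [h2, inner_add_right, inner_sub_right, real_inner_smul_right, real_inner_smul_right,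
        real_inner_self_eq_norm_sq, norm_dir]
      ring
    have h4 := inner_dir_le_norm φ' w
    have h5 : t * ρ * (1 - e ^ 2 / 32) ≤ t * ρ * inner ℝ (dir φ') (dir ψ) :=
      mul_le_mul_of_nonneg_left (by linarith) htρ0
    rw [hpb, dist_comm a b, dist_eq_norm b a]
    linarith
  have h6 : t * ρ * e ^ 2 ≤ 1 / 48 * ρ * e ^ 2 :=
    mul_le_mul_of_nonneg_right htρ' (sq_nonneg e)
  have h7 : 0 ≤ e ^ 2 * ρ := by positivity
  linarith

/-! ### The cones of the subdivision -/

theorem BoundaryRule.interval_subset_Icc (b : BoundaryRule) (α β : ℝ) :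
    b.interval α β ⊆ Set.Icc α β := by
  cases b
  exacts [subset_rfl, Set.Ico_subset_Icc_self, Set.Ioc_subset_Icc_self]

theorem BoundaryRule.add_mem_interval {b : BoundaryRule} {α a x : ℝ}
    (h : x ∈ b.interval α (α + a)) (c : ℝ) : x + c ∈ b.interval (α + c) (α + c + a) := by
  rw [add_right_comm]
  cases b <;> simpa [BoundaryRule.interval] using h

theorem BoundaryRule.exists_int_mem_interval (b : BoundaryRule) (θ φ : ℝ) {v : ℝ} (hv : 0 < v) :
    ∃ N : ℤ, φ ∈ b.interval (θ + N * v) (θ + N * v + v) := by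
  have hfl : ∃ N : ℤ, φ ∈ Set.Ico (θ + N * v) (θ + N * v + v) := by
    refine ⟨⌊(φ - θ) / v⌋, ?_, ?_⟩
    · have := (le_div_iff₀ hv).1 (Int.floor_le ((φ - θ) / v)); linarith
    · have := (div_lt_iff₀ hv).1 (Int.lt_floor_add_one ((φ - θ) / v)); linarith
  cases b
  · exact hfl.imp fun N h => Set.Ico_subset_Icc_self h
  · exact hfl
  -- Here the left endpoint is excluded, so the ceiling marks the right end of the interval.
  · refine ⟨⌈(φ - θ) / v⌉ - 1, ?_, ?_⟩
    · have := (lt_div_iff₀ hv).1 (sub_lt_iff_lt_add.2 (Int.ceil_lt_add_one ((φ - θ) / v)))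
      push_cast; linarith
    · have := (div_le_iff₀ hv).1 (Int.le_ceil ((φ - θ) / v))
      push_cast; linarith

theorem exists_fin_eq_emod {k : ℕ} (hk : 0 < k) (n : ℤ) :
    ∃ i : Fin k, ((i : ℕ) : ℤ) = n % k := by
  have hk' : (0 : ℤ) < k := by exact_mod_cast hk
  have h0 := Int.emod_nonneg n hk'.ne'
  have h1 := Int.emod_lt_of_pos n hk'
  exact ⟨⟨(n % k).toNat, by omega⟩, by simp [h0]⟩

theorem exists_mem_bigCone (b : BoundaryRule) (θ : ℝ) {k : ℕ} (hk : 0 < k) (s x : Plane) :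
    ∃ i : Fin k, x ∈ bigCone b θ i s := by
  have hk' : (0 : ℝ) < k := by exact_mod_cast hk
  obtain ⟨φ, hφ⟩ := exists_eq_norm_smul_dir (x - s)
  obtain ⟨N, hN⟩ := b.exists_int_mem_interval θ φ (v := 2 * Real.pi / k) (by positivity)
  obtain ⟨i, hi⟩ := exists_fin_eq_emod hk N
  -- Removing `N / k` full turns from the angle reduces the sector number `N` modulo `k`.
  refine ⟨i, ‖x - s‖, norm_nonneg _, φ + (-(N / k) : ℤ) * (2 * Real.pi), ?_, ?_⟩
  · have h := BoundaryRule.add_mem_interval hN ((-(N / k) : ℤ) * (2 * Real.pi))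
    have hi' : (i : ℝ) = N - k * ((N / k : ℤ) : ℝ) := by
      have : ((i : ℕ) : ℤ) = N - k * (N / k) := by rw [hi, Int.emod_def]
      exact_mod_cast congrArg (Int.cast : ℤ → ℝ) this
    have e : θ + N * (2 * Real.pi / k) + (-(N / k) : ℤ) * (2 * Real.pi) =
        θ + i * (2 * Real.pi / k) := by
      rw [hi']; push_cast; field_simp; ring
    rw [e] at h
    exact h
  · rw [dir_add_int_mul_two_pi]; exact hφ

/-- A direction near the cone `C_i` lies in a small cone of one of the three cones around it. -/
theorem exists_mem_smallCone_neighbors (b : BoundaryRule) (θ : ℝ) {k : ℕ} (i : Fin k)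
    {φ : ℝ} (h1 : θ + i * (2 * Real.pi / k) - 2 * Real.pi / k < φ)
    (h2 : φ < θ + i * (2 * Real.pi / k) + 2 * (2 * Real.pi / k)) :
    ∃ i' ∈ neighbors i, ∃ j : Fin k, ∃ m : ℤ,
      φ + m * (2 * Real.pi) ∈ b.interval
        (θ + i' * (2 * Real.pi / k) + j * (2 * Real.pi / k ^ 2))
        (θ + i' * (2 * Real.pi / k) + j * (2 * Real.pi / k ^ 2) + 2 * Real.pi / k ^ 2) := by
  have hk : 0 < k := i.pos
  have hk' : (0 : ℝ) < k := by exact_mod_cast hk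
  have hv : 0 < 2 * Real.pi / (k : ℝ) ^ 2 := by positivity
  -- `N` numbers the thin sectors consecutively around the circle: `N mod k` is `j`, and `N / k` is
  -- the number of the big sector before reduction modulo `k`.
  obtain ⟨N, hN⟩ := b.exists_int_mem_interval θ φ hv
  have hN' := b.interval_subset_Icc _ _ hN
  have hw : 2 * Real.pi / k = k * (2 * Real.pi / (k : ℝ) ^ 2) := by field_simp
  obtain ⟨j, hj⟩ := exists_fin_eq_emod hk N
  obtain ⟨i', hi'⟩ := exists_fin_eq_emod hk (N / k)
  have hNk : N = k * (N / k) + j := by rw [hj]; exact (Int.mul_ediv_add_emod N k).symm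
  have hNi : N / k = k * (N / k / k) + i' := by
    rw [hi']; exact (Int.mul_ediv_add_emod (N / k) k).symm
  have hjk : ((j : ℕ) : ℤ) < k := by exact_mod_cast j.2
  have hk0 : (0 : ℤ) < k := by exact_mod_cast hk
  -- The strict bounds on `φ` and integrality force `N / k` into `{i - 1, i, i + 1}` under every
  -- boundary rule.
  have hlow : ((i : ℕ) - 1 : ℤ) * k < N + 1 := by
    have : (((i : ℕ) - 1 : ℝ)) * k < N + 1 := by
      refine lt_of_mul_lt_mul_right ?_ hv.le
      rw [hw] at h1
      linarith [hN'.2]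
    exact_mod_cast this
  have hup : N < ((i : ℕ) + 2 : ℤ) * k := by
    have : (N : ℝ) < ((i : ℕ) + 2 : ℝ) * k := by
      refine lt_of_mul_lt_mul_right ?_ hv.le
      rw [hw] at h2
      linarith [hN'.1]
    exact_mod_cast this
  have hlow' : (i : ℤ) - 1 ≤ N / k := by
    rw [Int.le_ediv_iff_mul_le hk0]; omega
  have hup' : N / k < (i : ℤ) + 2 := by
    rwa [Int.ediv_lt_iff_lt_mul hk0]
  refine ⟨i', ⟨N / k - i, by omega, ?_⟩, j, -(N / k / k), ?_⟩
  · rw [add_sub_cancel, hi']; exact Int.mod_modEq _ _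
  · have h := BoundaryRule.add_mem_interval hN ((-(N / k / k) : ℤ) * (2 * Real.pi))
    have hNr : (N : ℝ) = k * (k * ((N / k / k : ℤ) : ℝ) + i') + j := by
      have : N = k * (k * (N / k / k) + i') + j := by rw [← hNi]; exact hNk
      exact_mod_cast congrArg (Int.cast : ℤ → ℝ) this
    have e : θ + N * (2 * Real.pi / k ^ 2) + (-(N / k / k) : ℤ) * (2 * Real.pi) =
        θ + i' * (2 * Real.pi / k) + j * (2 * Real.pi / k ^ 2) := by
      rw [hNr]; push_cast; field_simp; ring
    rw [e] at h
    exact h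

theorem abs_sub_le_of_mem_interval {b : BoundaryRule} {α a x y : ℝ}
    (hx : x ∈ b.interval α (α + a)) (hy : y ∈ b.interval α (α + a)) : |x - y| ≤ a := by
  have hx' := b.interval_subset_Icc _ _ hx
  have hy' := b.interval_subset_Icc _ _ hy
  rw [abs_le]
  constructor <;> linarith [hx'.1, hx'.2, hy'.1, hy'.2]

/-- The upper bound on the aperture controls angles within one `C_i`, the lower bound keeps a turn
of less than `e/10` within the neighboring cones, and the last bound makes the thin cones thin. The
constant `384 = 128 * 3` comes from `128π` and `π > 3`. -/
theorem numCones_bounds {e : ℝ} (he : 0 < e) (he3 : e < 1 / 3) :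
    0 < numCones (e ^ 2) ∧ 2 * Real.pi / numCones (e ^ 2) ≤ e / 8 ∧
      e / 10 ≤ 2 * Real.pi / numCones (e ^ 2) ∧
      2 * Real.pi / (numCones (e ^ 2) : ℝ) ^ 2 ≤ e ^ 2 / 384 := by
  have hpi := Real.pi_gt_three
  have h0 : 0 < 16 * Real.pi / e := by positivity
  have hk1 : 16 * Real.pi / e ≤ numCones (e ^ 2) := by
    rw [numCones, Real.sqrt_sq he.le]; exact Nat.le_ceil _
  have hk2 : (numCones (e ^ 2) : ℝ) < 16 * Real.pi / e + 1 := by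
    rw [numCones, Real.sqrt_sq he.le]; exact Nat.ceil_lt_add_one h0.le
  set k := numCones (e ^ 2)
  have hk : (0 : ℝ) < k := h0.trans_le hk1
  rw [div_le_iff₀ he] at hk1
  have hk2' : k * e < 16 * Real.pi + e := by
    have := mul_lt_mul_of_pos_right hk2 he
    rwa [add_mul, div_mul_cancel₀ _ he.ne', one_mul] at this
  refine ⟨by exact_mod_cast hk, ?_, ?_, ?_⟩
  · rw [div_le_iff₀ hk]; linarith
  · rw [le_div_iff₀ hk]; linarith
  · rw [div_le_iff₀ (by positivity)]
    have h1 : 16 * Real.pi * (16 * Real.pi) ≤ k * e * (k * e) :=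
      mul_le_mul hk1 hk1 (by positivity) (by positivity)
    nlinarith

/-! ### The spanner property -/

theorem isSpanner_graph {S : Finset Plane} {e : ℝ} (he : 0 < e) (he3 : e < 1 / 3)
    (P : Preprocessing S (e ^ 2)) : IsSpanner (graph P) (1 + e ^ 2) := by
  obtain ⟨hk, hw1, hw2, hv⟩ := numCones_bounds he he3
  have he2 : e ^ 2 < 1 / 9 := by nlinarith
  have he2' : 0 < e ^ 2 := by positivity
  suffices H : ∀ z : S × S, Joined (graph P) z.1 z.2 ((1 + e ^ 2) * dist z.1 z.2) by
    intro p q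
    obtain ⟨w, hw⟩ := H (p, q)
    obtain ⟨w', hw', hle⟩ := exists_isPath_weight_le w
    exact ⟨w', hw', hle.trans hw⟩
  have wf : WellFounded fun z z' : S × S => dist z.1 z.2 < dist z'.1 z'.2 :=
    haveI : IsTrans (S × S) fun z z' => dist z.1 z.2 < dist z'.1 z'.2 := ⟨fun _ _ _ => lt_trans⟩
    haveI : Std.Irrefl fun z z' : S × S => dist z.1 z.2 < dist z'.1 z'.2 := ⟨fun _ => lt_irrefl _⟩
    Finite.wellFounded_of_trans_of_irrefl _
  intro z
  induction z using wf.induction with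
  | _ z ih =>
  obtain ⟨a, b⟩ := z
  replace ih : ∀ x y : S, dist x y < dist a b →
      Joined (graph P) x y ((1 + e ^ 2) * dist x y) := fun x y h => ih (x, y) h
  show Joined (graph P) a b ((1 + e ^ 2) * dist a b)
  rcases eq_or_ne a b with rfl | hab
  · exact Joined.refl _ (by positivity)
  have hr : 0 < dist a b := dist_pos.2 hab
  obtain ⟨i, hbi⟩ := exists_mem_bigCone P.rule P.θ hk (a : Plane) b
  -- the closest point to `a` in its cone
  obtain ⟨c, hc, hca, hcb⟩ : ∃ c, P.q i a = some c ∧ c ≠ a ∧ dist a c ≤ dist a b := by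
    have h := P.q_spec i a
    cases hq : P.q i a with
    | none =>
      rw [hq] at h
      exact absurd (show b ∈ (∅ : Set S) from h ▸ ⟨hab.symm, hbi⟩) (Set.notMem_empty b)
    | some c =>
      rw [hq] at h
      exact ⟨c, rfl, h.1.1, h.2 b ⟨hab.symm, hbi⟩⟩
  -- the pair `(p, q)` that deletes `(a, c)`
  obtain ⟨p, q, hpq, hord, haA, hedge, hedges⟩ := exists_deleting_pair P i (axis P.θ i) _
    (P.L i) le_rfl (P.L_sorted i) (a, c) ((P.mem_L i (a, c)).2 hc)
  have hq := P.q_spec i p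
  rw [(P.mem_L i (p, q)).1 hpq] at hq
  obtain ⟨⟨hqp, hqcone⟩, -⟩ := hq
  have hρ : 0 < dist p q := dist_pos.2 hqp.symm
  have hac : 0 < dist a c := dist_pos.2 hca.symm
  -- A larger scale means a shorter edge; within one scale, lengths differ by a factor less than 2.
  have hscale : dist p q < 2 * dist a b := by
    refine lt_of_lt_of_le ?_ (mul_le_mul_of_nonneg_left hcb zero_le_two)
    rcases hord with h | h
    · rw [Prod.mk.injEq] at h
      rw [h.1, h.2]; linarith
    · have h1 : scale (dist a c) ≤ scale (dist p q) := by
        rcases h with h | ⟨h, -⟩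
        exacts [h.le, h.le]
      have h2 := ((scale_eq_iff hρ _).1 rfl).2
      have h3 := ((scale_eq_iff hac _).1 rfl).1
      calc dist p q < 2 ^ (1 - scale (dist p q)) := h2
        _ ≤ 2 ^ (1 + -scale (dist a c)) := zpow_le_zpow_right₀ one_le_two (by omega)
        _ = 2 * 2 ^ (-scale (dist a c)) := by rw [zpow_add₀ two_ne_zero, zpow_one]
        _ ≤ 2 * dist a c := mul_le_mul_of_nonneg_left h3 zero_le_two
  have haA' : (a : Plane) ∈ regionAHat (e ^ 2) p q := by
    rcases haA with h | h
    · exact h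
    · rw [show a = p from h]; exact self_mem_regionAHat he2'.le _ _
  -- polar coordinates
  obtain ⟨r, hr0, φ, hφ, hb⟩ := hbi
  obtain ⟨ρ, hρ0, ψ, hψ, hqψ⟩ := hqcone
  have hrab : r = dist a b := by
    rw [Subtype.dist_eq, dist_comm, dist_eq_norm, hb, norm_smul_dir hr0]
  have hρpq : ρ = dist p q := by
    rw [Subtype.dist_eq, dist_comm, dist_eq_norm, hqψ, norm_smul_dir hρ0]
  have hφψ := (abs_sub_le_of_mem_interval hφ hψ).trans hw1
  obtain ⟨φ', hφ', hdφ, hpb, hap, hslack⟩ := exists_angle_and_detour_bounds he he3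
    (hρpq ▸ hρ) (by rw [hρpq, hrab]; exact hscale) hqψ hb hφψ haA'
  rw [← dist_eq_norm, dist_comm] at hφ'
  simp only [← Subtype.dist_eq] at hpb hap hslack hφ'
  rw [hρpq] at hpb hslack
  have hφI := P.rule.interval_subset_Icc _ _ hφ
  obtain ⟨hd1, hd2⟩ := abs_lt.1 hdφ
  obtain ⟨i', hi', j, m, hm⟩ := exists_mem_smallCone_neighbors P.rule P.θ i
    (φ := φ') (by linarith [hφI.1]) (by linarith [hφI.2])
  have hb' : (b : Plane) - p = dist p b • dir (φ' + m * (2 * Real.pi)) := by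
    rw [dir_add_int_mul_two_pi]; exact hφ'
  have hbs : (b : Plane) ∈ smallCone P.rule P.θ i' j p := ⟨_, dist_nonneg, _, hm, hb'⟩
  obtain ⟨x, hx, ⟨hxs, hpx⟩, hpxb⟩ : ∃ x, P.qq i' j p (dist p q / 3) = some x ∧
      ((x : Plane) ∈ smallCone P.rule P.θ i' j p ∧ dist p q / 3 < dist p x) ∧
      dist p x ≤ dist p b := by
    have h := P.qq_spec i' j p (dist p q / 3) (by positivity)
    cases hx : P.qq i' j p (dist p q / 3) with
    | none =>
      rw [hx] at h
      exact absurd (show b ∈ (∅ : Set S) from h ▸ ⟨hbs, hpb⟩) (Set.notMem_empty b)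
    | some x =>
      rw [hx] at h
      exact ⟨x, rfl, h.1, h.2 b ⟨hbs, hpb⟩⟩
  have hxb : dist x b ≤ dist p b - (1 - e ^ 2 / 384) * dist p x := by
    obtain ⟨s, hs0, χ, hχ, hxχ⟩ := hxs
    have hs : s = dist p x := by
      rw [Subtype.dist_eq, dist_comm, dist_eq_norm, hxχ, norm_smul_dir hs0]
    rw [Subtype.dist_eq, dist_comm, dist_eq_norm, ← sub_sub_sub_cancel_right _ _ (p : Plane),
      hb', hxχ, hs]
    exact norm_smul_dir_sub_smul_dir_le dist_nonneg hpxb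
      ((abs_sub_le_of_mem_interval hm hχ).trans hv)
  have hadj : ∀ y, p ≠ y → s(p, y) ∈ loopEdges P i (P.L i) → (graph P).Adj p y := fun y hy h =>
    (SimpleGraph.fromEdgeSet_adj _).2 ⟨Set.mem_iUnion.2 ⟨i, h⟩, hy⟩
  -- it remains to continue from `p` over a neighbor `y`
  have key : ∀ y, p ≠ y → s(p, y) ∈ loopEdges P i (P.L i) →
      (1 + e ^ 2) * (dist a p + dist y b - dist a b) + dist p y ≤ 0 →
      Joined (graph P) a b ((1 + e ^ 2) * dist a b) := by
    intro y hy h hle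
    have hpy : 0 < dist p y := dist_pos.2 hy
    have hyb : dist y b < dist a b := by
      have h0 : 0 ≤ dist a p := dist_nonneg
      -- If `y` were no closer to `b` than `a` is, the left side of `hle` would be positive because
      -- of `dist p y`.
      by_contra! h1
      nlinarith [mul_nonneg (by linarith : 0 ≤ 1 + e ^ 2)
        (by linarith : 0 ≤ dist a p + dist y b - dist a b)]
    refine (((ih a p hap).trans (Joined.of_adj (hadj y hy h))).trans (ih y b hyb)).mono ?_
    linarith
  have hεε : e ^ 2 * e ^ 2 ≤ 1 / 9 * e ^ 2 := mul_le_mul_of_nonneg_right he2.le he2'.le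
  by_cases hxB : (x : Plane) ∈ regionB (e ^ 2) p q
  · refine key q hqp.symm hedge ?_
    have hqb : dist p q + dist q b - dist p b ≤ e ^ 2 / 4 * dist p q := by
      have hερ : 0 ≤ e ^ 2 * dist p q := by positivity
      -- For far `b` the angle at `p` suffices. For near `b`, going on from `q` over `x` costs `ε/8`
      -- from `W₂` and at most `2ε/384` from the thin cone, in units of `dist p q`.
      rcases le_total (2 * dist p q) (dist p b) with hD | hD
      · have hγ : (φ' - ψ) ^ 2 ≤ e ^ 2 / 4 := by
          have h1 := abs_add_le (φ' - φ) (φ - ψ)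
          rw [sub_add_sub_cancel] at h1
          have h2 : |φ' - ψ| ≤ e / 2 := by linarith
          have := sq_le_sq' (by linarith [abs_nonneg (φ' - ψ)]) h2
          rw [sq_abs] at this
          linarith
        have := norm_smul_dir_sub_smul_dir_le_of_two_mul_le hρ.le hD hγ
        rw [← hφ', ← hρpq, ← hqψ, sub_sub_sub_cancel_right, ← dist_eq_norm, dist_comm, hρpq,
          ← Subtype.dist_eq] at this
        linarith
      · have h1 := dist_add_dist_sub_dist_le_of_mem_cone
          (by rw [Real.sqrt_sq he.le]; linarith [Real.pi_gt_three]) hxB.2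
        rw [Real.sqrt_sq he.le] at h1
        simp only [← Subtype.dist_eq] at h1
        have h2 := dist_triangle q x b
        have h3 : e ^ 2 * dist p x ≤ e ^ 2 * (2 * dist p q) :=
          mul_le_mul_of_nonneg_left (hpxb.trans hD) he2'.le
        linarith
    have h1 : dist a p + dist q b - dist a b ≤ (e ^ 2 * (1 / 30 + 1 / 4) - 1) * dist p q := by
      linarith
    have h2 := mul_le_mul_of_nonneg_left h1 (by linarith : 0 ≤ 1 + e ^ 2)
    have h3 : (1 + e ^ 2) * (e ^ 2 * (1 / 30 + 1 / 4) - 1) + 1 ≤ 0 := by nlinarith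
    have h4 := mul_le_mul_of_nonneg_right h3 hρ.le
    linarith
  · have hpx0 : p ≠ x := fun h => by
      rw [← h, dist_self] at hpx; linarith
    refine key x hpx0 (hedges i' hi' j x hx hxB) ?_
    -- The threshold `‖pq‖ / 3` serves here: it lets the new edge `px` pay for the detour over `p`,
    -- which is measured in `‖pq‖`.
    have h0 : e ^ 2 / 30 * dist p q ≤ e ^ 2 / 30 * (3 * dist p x) :=
      mul_le_mul_of_nonneg_left (by linarith) (by positivity)
    have h1 : dist a p + dist x b - dist a b ≤
        (e ^ 2 * (1 / 10 + 1 / 384) - 1) * dist p x := by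
      linarith
    have h2 := mul_le_mul_of_nonneg_left h1 (by linarith : 0 ≤ 1 + e ^ 2)
    have h3 : (1 + e ^ 2) * (e ^ 2 * (1 / 10 + 1 / 384) - 1) + 1 ≤ 0 := by nlinarith
    have h4 := mul_le_mul_of_nonneg_right h3 (dist_nonneg (x := p) (y := x))
    linarith

end SparseYao

/-- For every finite point set in the plane and every `ε ∈ (0, 1/9)`, the graph that the algorithm
returns is a `(1 + ε)`-spanner, whatever choices the algorithm makes. -/
theorem mainTheorem4 (S : Finset SparseYao.Plane) (ε : ℝ) (hε0 : 0 < ε) (hε : ε < 1 / 9)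
    (P : SparseYao.Preprocessing S ε) :
    SparseYao.IsSpanner (SparseYao.graph P) (1 + ε) := by
  obtain ⟨e, he, rfl⟩ : ∃ e : ℝ, 0 < e ∧ e ^ 2 = ε := ⟨√ε, Real.sqrt_pos.2 hε0, Real.sq_sqrt hε0.le⟩
  exact SparseYao.isSpanner_graph he (by nlinarith) P
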